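/- **Definitions.** All compact Hausdorff spaces $X$, $X_j$, $Y$, $Y_j$ below are non-empty, $C(X)$ denotes the algebra of complex-valued continuous functions on $X$, $C_{\mathbb R}(X)\subset C(X)$ the real-valued ones, and $\|\cdot\|_{\infty(X)}$ is the supremum norm. A unital subalgebra $A$ of $C(X)$ equipped with a Banach algebra norm (a complete submultiplicative norm) is *self-adjoint* if it is closed under complex conjugation and every unital multiplicative linear functional on $A$ is the evaluation $f\mapsto f(x)$ at exactly one point $x\in X$. For $f\in C(X)$ and $g\in C(Y)$ let $(f\otimes g)(x,y)=f(x)g(y)$; for a subspace $E$ of $C(X)$, $E\otimes C(Y)$ is the set of finite sums of functions $f\otimes g$ with $f\in E$, $g\in C(Y)$, and $1\otimes C(Y)=\{1\otimes g: g\in C(Y)\}$. Let $B$ be a unital point-separating subalgebra of $C(X)$ equipped with a Banach algebra norm, and suppose that $B$ is self-adjoint. Let $\widetilde B$ be a unital point-separating subalgebra of $C(X\times Y)$ with $B\otimes C(Y)\subset\widetilde B$, equipped with a Banach algebra norm $\|\cdot\|_{\widetilde B}$, and suppose that $\widetilde B$ is self-adjoint. Then $\widetilde B$ is a *natural $C(Y)$-valuezation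 of $B$* if there exist a compact Hausdorff space $\mathfrak M$ and a complex-linear map $D:\widetilde B\to C(\mathfrak M)$ such that $\ker D=1\otimes C(Y)$, $D(C_{\mathbb R}(X\times Y)\cap\widetilde B)\subset C_{\mathbb R}(\mathfrak M)$, and $$\|F\|_{\widetilde B}=\|F\|_{\infty(X\times Y)}+\|D(F)\|_{\infty(\mathfrak M)},\qquad F\in\widetilde B.$$ **Theorem 5.1.** For $j=1,2$ let $\widetilde{B_j}$ be a natural $C(Y_j)$-valuezation of $B_j\subset C(X_j)$, and assume that $$\|(1\otimes h)F\|_{\widetilde{B_j}}=\|F\|_{\widetilde{B_j}}$$ for every $F\in\widetilde{B_j}$ and every $h\in C(Y_j)$ with $|h|=1$ on $Y_j$. Let $U:\widetilde{B_1}\to\widetilde{B_2}$ be a surjective complex-linear isometry. Then there exist $h\in C(Y_2)$ with $|h|=1$ on $Y_2$, a continuous map $\varphi:X_2\times Y_2\to X_1$ such that $\varphi(\cdot,y):X_2\to X_1$ is a homeomorphism for each $y\in Y_2$, and a homeomorphism $\tau:Y_2\to Y_1$ such that $$U(F)(x,y)=h(y)\,F(\varphi(x,y),\tau(y)),\qquad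 (x,y)\in X_2\times Y_2,$$ for every $F\in\widetilde{B_1}$. -/

import Mathlib

open Filter Topology

/-- The norm `N` on the complex algebra `A` is complete. An `AlgebraNorm ℂ A` is a
submultiplicative norm on `A` that is homogeneous over `ℂ`; together with completeness it is a
Banach algebra norm. -/
def IsCompleteNorm {A : Type*} [Ring A] [Algebra ℂ A] (N : AlgebraNorm ℂ A) : Prop :=
  ∀ u : ℕ → A,
    (∀ ε : ℝ, 0 < ε → ∃ n₀ : ℕ, ∀ m ≥ n₀, ∀ n ≥ n₀, N (u m - u n) < ε) →
      ∃ a : A, Tendsto (fun n => N (u n - a)) atTop (𝓝 0)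

/-- The point evaluation `f ↦ f x` as a character (unital multiplicative linear functional)
of the unital subalgebra `B` of `C(X)`. -/
noncomputable def pointEval {X : Type*} [TopologicalSpace X] (B : Subalgebra ℂ C(X, ℂ)) (x : X) :
    B →ₐ[ℂ] ℂ :=
  (ContinuousMap.evalAlgHom ℂ ℂ x).comp B.val

/-- `B` is natural: `x ↦ (f ↦ f x)` is a bijection of `X` onto the set of all characters of `B`,
which is the maximal ideal space of `B` (every character of a Banach algebra is continuous). -/
def IsNaturalAlgebra {X : Type*} [TopologicalSpace X] (B : Subalgebra ℂ C(X, ℂ)) : Prop :=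
  Function.Bijective (pointEval B)

/-- `B` is self-adjoint: it is natural and closed under complex conjugation. -/
def IsSelfAdjointAlgebra {X : Type*} [TopologicalSpace X] (B : Subalgebra ℂ C(X, ℂ)) : Prop :=
  IsNaturalAlgebra B ∧ ∀ f ∈ B, star f ∈ B

/-- The function `f ⊗ g` on `X × Y`, that is, `(x, y) ↦ f x * g y`. -/
noncomputable def tensorFun {X Y : Type*} [TopologicalSpace X] [TopologicalSpace Y]
    (f : C(X, ℂ)) (g : C(Y, ℂ)) : C(X × Y, ℂ) where
  toFun p := f p.1 * g p.2
  continuous_toFun := by fun_prop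

/-- The space `E ⊗ E'` of all finite sums of functions `f ⊗ g` with `f ∈ E` and `g ∈ E'`. -/
noncomputable def tensorSpace {X Y : Type*} [TopologicalSpace X] [TopologicalSpace Y]
    (E : Submodule ℂ C(X, ℂ)) (E' : Submodule ℂ C(Y, ℂ)) : Submodule ℂ C(X × Y, ℂ) :=
  Submodule.span ℂ {F | ∃ f ∈ E, ∃ g ∈ E', F = tensorFun f g}

universe u v w w₁ w₂

/-- `Bt`, with the norm `nBt`, is a natural `C(Y)`-valuezation of `B ⊆ C(X)`, where `B` carries the
norm `nB`. The compact Hausdorff space that the map `D` of the definition refers to may live in any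
universe `w`. -/
structure IsNaturalValuezation {X : Type u} {Y : Type v}
    [TopologicalSpace X] [CompactSpace X] [T2Space X]
    [TopologicalSpace Y] [CompactSpace Y] [T2Space Y]
    (B : Subalgebra ℂ C(X, ℂ)) (nB : AlgebraNorm ℂ B)
    (Bt : Subalgebra ℂ C(X × Y, ℂ)) (nBt : AlgebraNorm ℂ Bt) : Prop where
  complete_base : IsCompleteNorm nB
  separates_base : B.SeparatesPoints
  selfAdjoint_base : IsSelfAdjointAlgebra B
  complete : IsCompleteNorm nBt
  separates : Bt.SeparatesPoints
  selfAdjoint : IsSelfAdjointAlgebra Bt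
  tensor_le : tensorSpace (Subalgebra.toSubmodule B) (⊤ : Submodule ℂ C(Y, ℂ)) ≤
    Subalgebra.toSubmodule Bt
  exists_map : ∃ (M : Type w) (_ : TopologicalSpace M) (_ : CompactSpace M) (_ : T2Space M)
    (D : Bt →ₗ[ℂ] C(M, ℂ)),
      -- the kernel of `D` is `1 ⊗ C(Y)`
      (∀ F : Bt, D F = 0 ↔ ∃ g : C(Y, ℂ), (F : C(X × Y, ℂ)) = tensorFun 1 g) ∧
      -- `D` maps real-valued functions to real-valued functions
      (∀ F : Bt, (∀ p, ((F : C(X × Y, ℂ)) p).im = 0) → ∀ m, (D F m).im = 0) ∧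
      -- the norms on the right are the supremum norms on `X × Y` and on `M`
      (∀ F : Bt, nBt F = ‖(F : C(X × Y, ℂ))‖ + ‖D F‖)

/-! Each norm is ‖F‖ + d(F), where ‖·‖ is the sup norm and the seminorm d vanishes exactly on 1 ⊗
C(Y). Information is read off one-sided directional derivatives (Danskin): the derivative of ‖f +
tw‖ at t = 0+ is the maximum of Re(conj f · w)/‖f‖ over the points where |f| attains its norm, and
similarly for max Re. The perturbations are chosen so that the seminorms cancel or are controlled.

Let v = U 1. By `exists_phase` every nonzero G has a norming point where |v| is maximal; peak
functions then make |v| a constant c. Adding two different constants to one peak function leaves its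
seminorm alone but changes its phase at the peak, and comparing derivatives gives 1 ≤ c
(`one_le_norm_map_one`). Since c + d(v) = 1, d(v) = 0, so v = 1 ⊗ h with |h| = 1. Multiplying by
conj h reduces to U 1 = 1.

For unital U, differentiating the norm at 1 gives max Re(zUF) + d₂(UF) = max Re(zF) + d₁(F) for |z|
= 1. The crux is d₁(F) ≤ d₂(UF) for real F (`seminorm_le_of_real`): it forces UF to be real with the
same maximum. Peak functions and compactness then give UF = F ∘ σ with σ a homeomorphism.
Composition with σ preserves the sup norm, hence d, hence 1 ⊗ C(Y), so the second coordinate of σ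
depends on y alone. -/

/-! ### One-sided directional derivatives of the sup norm and of max Re. -/

section Danskin

/-- The supremum of the real part of a continuous function. -/
noncomputable def maxRe {K : Type*} [TopologicalSpace K] (F : C(K, ℂ)) : ℝ := ⨆ x, (F x).re

theorem maxRe_le {K : Type*} [TopologicalSpace K] [Nonempty K] {F : C(K, ℂ)} {a : ℝ}
    (h : ∀ x, (F x).re ≤ a) : maxRe F ≤ a :=
  ciSup_le h

variable {K : Type*} [TopologicalSpace K] [CompactSpace K]

/-- A compactness principle: if `g < α` wherever `f` attains the bound `c`, there is a uniform
gap. -/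
theorem exists_gap_of_lt_on_argmax [Nonempty K] {f g : K → ℝ} (hf : Continuous f)
    (hg : Continuous g) {c α : ℝ} (hfc : ∀ x, f x ≤ c) (h : ∀ x, f x = c → g x < α) :
    ∃ ε > 0, ∀ x, f x ≤ c - ε ∨ g x ≤ α - ε := by
  obtain ⟨x₀, -, hx₀⟩ := isCompact_univ.exists_isMaxOn Set.univ_nonempty
    ((hf.sub continuous_const).min (hg.sub continuous_const) :
      Continuous fun x => min (f x - c) (g x - α)).continuousOn
  have hneg : min (f x₀ - c) (g x₀ - α) < 0 := by
    rcases (hfc x₀).lt_or_eq with h1 | h1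
    · exact min_lt_of_left_lt (by linarith)
    · exact min_lt_of_right_lt (by linarith [h x₀ h1])
  refine ⟨-min (f x₀ - c) (g x₀ - α), by linarith, fun x => ?_⟩
  have hx : min (f x - c) (g x - α) ≤ min (f x₀ - c) (g x₀ - α) := hx₀ (Set.mem_univ x)
  rcases min_le_iff.1 hx with h1 | h1
  · left; linarith
  · right; linarith

theorem re_le_maxRe (F : C(K, ℂ)) (x : K) : (F x).re ≤ maxRe F :=
  le_ciSup (f := fun x => (F x).re)
    (isCompact_range (Complex.continuous_re.comp F.continuous)).bddAbove x

theorem le_maxRe_add_smul {F : C(K, ℂ)} (w : C(K, ℂ)) {x : K} (hx : (F x).re = maxRe F)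
    (t : ℝ) : maxRe F + t * (w x).re ≤ maxRe (F + (t : ℂ) • w) := by
  have := re_le_maxRe (F + (t : ℂ) • w) x
  simpa [hx] using this

/-- Lower bound for the one-sided directional derivative of the supremum norm. -/
theorem le_norm_add_smul {f : C(K, ℂ)} (hf : f ≠ 0) (w : C(K, ℂ)) {x : K} (hx : ‖f x‖ = ‖f‖)
    (t : ℝ) : ‖f‖ + t * ((starRingEnd ℂ (f x) * w x).re / ‖f‖) ≤ ‖f + (t : ℂ) • w‖ := by
  have hR : 0 < ‖f‖ := norm_pos_iff.2 hf
  have h1 : (starRingEnd ℂ (f x) * (f x + t * w x)).re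
      = ‖f‖ ^ 2 + t * (starRingEnd ℂ (f x) * w x).re := by
    rw [← hx, Complex.sq_norm, Complex.normSq_apply]
    simp
    ring
  have h2 : (starRingEnd ℂ (f x) * (f x + t * w x)).re ≤ ‖f‖ * ‖f + (t : ℂ) • w‖ := by
    refine (Complex.re_le_norm _).trans ?_
    rw [norm_mul, RCLike.norm_conj, hx]
    have := (f + (t : ℂ) • w).norm_coe_le_norm x
    simp only [ContinuousMap.add_apply, ContinuousMap.smul_apply, smul_eq_mul] at this
    gcongr
  rw [h1] at h2
  have h3 : ‖f‖ * (‖f‖ + t * ((starRingEnd ℂ (f x) * w x).re / ‖f‖))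
      = ‖f‖ ^ 2 + t * (starRingEnd ℂ (f x) * w x).re := by
    field_simp
  exact le_of_mul_le_mul_left (h3 ▸ h2) hR

variable [Nonempty K]

theorem exists_re_eq_maxRe (F : C(K, ℂ)) : ∃ x, (F x).re = maxRe F := by
  obtain ⟨x, -, hx⟩ := isCompact_univ.exists_isMaxOn Set.univ_nonempty
    (Complex.continuous_re.comp F.continuous).continuousOn
  exact ⟨x, le_antisymm (re_le_maxRe F x) (maxRe_le fun y => hx (Set.mem_univ y))⟩

theorem maxRe_lt {F : C(K, ℂ)} {a : ℝ} (h : ∀ x, (F x).re < a) : maxRe F < a := by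
  obtain ⟨x, hx⟩ := exists_re_eq_maxRe F
  exact hx ▸ h x

/-- Upper bound for the one-sided directional derivative of `maxRe`. -/
theorem eventually_maxRe_add_smul_lt (F w : C(K, ℂ)) {α : ℝ}
    (h : ∀ x, (F x).re = maxRe F → (w x).re < α) :
    ∀ᶠ t : ℝ in 𝓝[>] 0, maxRe (F + (t : ℂ) • w) < maxRe F + t * α := by
  obtain ⟨ε, hε, hgap⟩ := exists_gap_of_lt_on_argmax
    (Complex.continuous_re.comp F.continuous) (Complex.continuous_re.comp w.continuous)
    (re_le_maxRe F) h
  have hpos : 0 < ε / (|maxRe w| + |α| + 1) := by positivity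
  filter_upwards [Ioo_mem_nhdsGT hpos] with t ht
  obtain ⟨ht0, ht1⟩ := ht
  rw [lt_div_iff₀ (by positivity)] at ht1
  refine maxRe_lt fun x => ?_
  have hx : ((F + (t : ℂ) • w) x).re = (F x).re + t * (w x).re := by simp
  rw [hx]
  rcases hgap x with h1 | h1
  · have h1 : (F x).re ≤ maxRe F - ε := h1
    have h2 := mul_le_mul_of_nonneg_left
      ((re_le_maxRe w x).trans (le_abs_self _)) ht0.le
    have h3 := mul_le_mul_of_nonneg_left (neg_abs_le α) ht0.le
    linarith
  · have h1 : (w x).re ≤ α - ε := h1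
    have h2 := mul_le_mul_of_nonneg_left h1 ht0.le
    have h3 := mul_pos ht0 hε
    linarith [re_le_maxRe F x]

/-- Upper bound for the one-sided directional derivative of the supremum norm. -/
theorem eventually_norm_add_smul_lt {f : C(K, ℂ)} (hf : f ≠ 0) (w : C(K, ℂ)) {α : ℝ}
    (h : ∀ x, ‖f x‖ = ‖f‖ → (starRingEnd ℂ (f x) * w x).re < α * ‖f‖) :
    ∀ᶠ t : ℝ in 𝓝[>] 0, ‖f + (t : ℂ) • w‖ < ‖f‖ + t * α := by
  have hR : 0 < ‖f‖ := norm_pos_iff.2 hf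
  obtain ⟨ε, hε, hgap⟩ := exists_gap_of_lt_on_argmax (f := fun x => ‖f x‖)
    (g := fun x => (starRingEnd ℂ (f x) * w x).re) (by fun_prop) (by fun_prop)
    (fun x => f.norm_coe_le_norm x) h
  -- The three bounds on t handle, in order, the points where |f| ≤ ‖f‖ - ε, the quadratic term
  -- t²‖w‖² at the other points, and the positivity of ‖f‖ + tα.
  have hpos : 0 < ε / (‖w‖ + |α| + 1) := by positivity
  have hpos2 : 0 < 2 * ε / (‖w‖ ^ 2 + 1) := by positivity
  have hpos3 : 0 < ‖f‖ / (|α| + 1) := by positivity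
  filter_upwards [Ioo_mem_nhdsGT hpos, Ioo_mem_nhdsGT hpos2, Ioo_mem_nhdsGT hpos3] with t ht ht' ht''
  obtain ⟨ht0, ht1⟩ := ht
  have ht2 := ht'.2
  have ht3 := ht''.2
  rw [lt_div_iff₀ (by positivity)] at ht1 ht2 ht3
  have hα := mul_le_mul_of_nonneg_left (neg_abs_le α) ht0.le
  have hsum : 0 < ‖f‖ + t * α := by linarith
  rw [ContinuousMap.norm_lt_iff _ hsum]
  intro x
  have hwx := w.norm_coe_le_norm x
  have hfx := f.norm_coe_le_norm x
  have hx : (f + (t : ℂ) • w) x = f x + t * w x := by simp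
  rw [hx]
  rcases hgap x with h1 | h1
  · have h2 : ‖(t : ℂ) * w x‖ ≤ t * ‖w‖ := by
      rw [norm_mul, Complex.norm_real, Real.norm_of_nonneg ht0.le]
      exact mul_le_mul_of_nonneg_left hwx ht0.le
    have h3 := norm_add_le (f x) (t * w x)
    have h1 : ‖f x‖ ≤ ‖f‖ - ε := h1
    linarith
  · refine lt_of_pow_lt_pow_left₀ 2 hsum.le ?_
    have h1 : (starRingEnd ℂ (f x) * w x).re ≤ α * ‖f‖ - ε := h1
    have h2 : ‖f x + t * w x‖ ^ 2
        = ‖f x‖ ^ 2 + 2 * (t * (starRingEnd ℂ (f x) * w x).re) + t ^ 2 * ‖w x‖ ^ 2 := by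
      simp only [Complex.sq_norm, Complex.normSq_apply]
      simp
      ring
    rw [h2]
    have h3 := mul_le_mul_of_nonneg_left h1 ht0.le
    have h4 : ‖f x‖ ^ 2 ≤ ‖f‖ ^ 2 := by gcongr
    have h5 : t ^ 2 * ‖w x‖ ^ 2 ≤ t ^ 2 * ‖w‖ ^ 2 := by gcongr
    have h6 := mul_lt_mul_of_pos_left ht2 ht0
    nlinarith [sq_nonneg (t * α)]

end Danskin

/-! ### Density of real functions and peak functions. -/

section Peak

variable {K : Type*} [TopologicalSpace K] [CompactSpace K]

theorem exists_real_near {A : Subalgebra ℂ C(K, ℂ)} (hsep : A.SeparatesPoints)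
    (hstar : ∀ f ∈ A, star f ∈ A) (e : C(K, ℝ)) {ε : ℝ} (hε : 0 < ε) :
    ∃ F ∈ A, (∀ x, (F x).im = 0) ∧ ∀ x, |(F x).re - e x| < ε := by
  let S : StarSubalgebra ℂ C(K, ℂ) := { A with star_mem' := fun {a} ha => hstar a ha }
  have hS := ContinuousMap.starSubalgebra_topologicalClosure_eq_top_of_separatesPoints S hsep
  let E : C(K, ℂ) := ⟨fun x => (e x : ℂ), by fun_prop⟩
  have hE : E ∈ closure (A : Set C(K, ℂ)) := by
    have : E ∈ S.topologicalClosure := hS ▸ StarSubalgebra.mem_top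
    exact this
  obtain ⟨F, hF, hFE⟩ := Metric.mem_closure_iff.1 hE ε hε
  refine ⟨(2⁻¹ : ℂ) • (F + star F), A.smul_mem (A.add_mem hF (hstar F hF)) _, fun x => by simp,
    fun x => ?_⟩
  have h1 : (((2⁻¹ : ℂ) • (F + star F)) x).re = (F x).re := by
    simp
    ring
  rw [h1, abs_sub_comm]
  have h2 : ‖E x - F x‖ < ε := by
    rw [dist_eq_norm] at hFE
    exact ((E - F).norm_coe_le_norm x).trans_lt hFE
  have h3 := (Complex.abs_re_le_norm (E x - F x)).trans_lt h2
  simpa [E] using h3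

variable [T2Space K]

theorem exists_peak {A : Subalgebra ℂ C(K, ℂ)} (hsep : A.SeparatesPoints)
    (hstar : ∀ f ∈ A, star f ∈ A) {p : K} {W : Set K} (hW : IsOpen W) (hp : p ∈ W) :
    ∃ F ∈ A, (∀ x, (F x).im = 0) ∧ (∀ x, 0 ≤ (F x).re ∧ (F x).re ≤ 1) ∧ (∃ x, (F x).re = 1) ∧
      ∀ x, (F x).re = 1 → x ∈ W := by
  have : Nonempty K := ⟨p⟩
  obtain ⟨e, he0, he1, he⟩ := exists_continuous_zero_one_of_isClosed
    hW.isClosed_compl (isClosed_singleton (x := p)) (by simpa using hp)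
  -- After the shift by 1/4 the function is nonnegative, at least 1 at p and below 1/2 off W;
  -- dividing by its maximum then gives the peak.
  obtain ⟨F, hF, hFim, hFe⟩ := exists_real_near hsep hstar e (ε := 1 / 4) (by norm_num)
  have hG : F + algebraMap ℂ C(K, ℂ) (1 / 4) ∈ A := A.add_mem hF (A.algebraMap_mem _)
  set G := F + algebraMap ℂ C(K, ℂ) (1 / 4) with hGdef
  have hGre : ∀ x, (G x).re = (F x).re + 1 / 4 := fun x => by
    simp [hGdef]
  have hGim : ∀ x, (G x).im = 0 := fun x => by
    simp [hGdef, hFim]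
  have hlow : ∀ x, 0 ≤ (G x).re := fun x => by
    have := abs_lt.1 (hFe x)
    linarith [hGre x, (he x).1]
  have hpm : 1 ≤ maxRe G := by
    have := abs_lt.1 (hFe p)
    have h2 := he1 (Set.mem_singleton p)
    simp only [Pi.one_apply] at h2
    linarith [hGre p, re_le_maxRe G p]
  have hpos : 0 < maxRe G := by linarith
  have hre : ∀ x, ((((maxRe G)⁻¹ : ℝ) : ℂ) • G) x = (((maxRe G)⁻¹ * (G x).re : ℝ) : ℂ) := by
    intro x
    apply Complex.ext <;> simp [hGim]
  refine ⟨(((maxRe G)⁻¹ : ℝ) : ℂ) • G, A.smul_mem hG _, fun x => ?_, fun x => ?_, ?_, fun x => ?_⟩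
  · rw [hre, Complex.ofReal_im]
  · rw [hre, Complex.ofReal_re]
    refine ⟨mul_nonneg (inv_nonneg.2 hpos.le) (hlow x), ?_⟩
    rw [inv_mul_le_iff₀ hpos, mul_one]
    exact re_le_maxRe G x
  · obtain ⟨x, hx⟩ := exists_re_eq_maxRe G
    exact ⟨x, by rw [hre, Complex.ofReal_re, hx, inv_mul_cancel₀ hpos.ne']⟩
  · rw [hre, Complex.ofReal_re, inv_mul_eq_one₀ hpos.ne']
    intro hx
    by_contra hxW
    have h1 := he0 hxW
    simp only [Pi.zero_apply] at h1
    have := abs_lt.1 (hFe x)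
    linarith [hGre x]

end Peak

/-! ### The image of 1 is unimodular. -/

section UnitImage

theorem Complex.eq_ofReal_of_norm_le_of_le_re {z : ℂ} {r : ℝ} (h1 : ‖z‖ ≤ r) (h2 : r ≤ z.re) :
    z = r := by
  have h3 := Complex.re_le_norm z
  have h4 : z.re = ‖z‖ := by linarith
  have h5 : z.re = r := by linarith
  have h6 : z.im = 0 := by
    have := Complex.abs_re_eq_norm.1 (show |z.re| = ‖z‖ by rw [h4, abs_of_nonneg (norm_nonneg z)])
    exact this
  exact Complex.ext (by simp [h5]) (by simp [h6])

theorem exists_norm_eq_norm {K : Type*} [TopologicalSpace K] [CompactSpace K] [Nonempty K]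
    (f : C(K, ℂ)) : ∃ x, ‖f x‖ = ‖f‖ := by
  obtain ⟨x, -, hx⟩ := isCompact_univ.exists_isMaxOn Set.univ_nonempty
    (f.continuous.norm).continuousOn
  exact ⟨x, le_antisymm (f.norm_coe_le_norm x)
    ((ContinuousMap.norm_le _ (norm_nonneg _)).2 fun y => hx (Set.mem_univ y))⟩

theorem Seminorm.map_add_smul_of_eq_zero {E : Type*} [AddCommGroup E] [Module ℂ E]
    (d : Seminorm ℂ E) {e : E} (he : d e = 0) (a : E) (z : ℂ) : d (a + z • e) = d a := by
  have h0 : d (z • e) = 0 := by rw [map_smul_eq_mul, he, mul_zero]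
  refine le_antisymm ((map_add_le_add d _ _).trans (by rw [h0, add_zero])) ?_
  have := map_sub_le_add d (a + z • e) (z • e)
  rwa [add_sub_cancel_right, h0, add_zero] at this

/-- For a real function `F` with values in `[0, 1]` that attains `1`, the modulus of `l + F`
peaks exactly where `F` does. -/
theorem norm_const_add_eq {K : Type*} [TopologicalSpace K] [CompactSpace K] {F : C(K, ℂ)}
    (hFim : ∀ x, (F x).im = 0) (hF01 : ∀ x, 0 ≤ (F x).re ∧ (F x).re ≤ 1)
    (hF1 : ∃ x, (F x).re = 1) {l : ℂ} (hl : 0 ≤ l.re) :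
    ‖F + l • (1 : C(K, ℂ))‖ = ‖l + 1‖ ∧
      ∀ x, ‖(F + l • (1 : C(K, ℂ))) x‖ = ‖F + l • (1 : C(K, ℂ))‖ → (F x).re = 1 ∧ F x = 1 := by
  have hval : ∀ x, (F + l • (1 : C(K, ℂ))) x = l + ((F x).re : ℂ) := fun x => by
    apply Complex.ext <;> simp [hFim, add_comm]
  have hsq : ∀ s : ℝ, ‖l + (s : ℂ)‖ ^ 2 = ‖l‖ ^ 2 + 2 * s * l.re + s ^ 2 := fun s => by
    simp only [Complex.sq_norm, Complex.normSq_apply]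
    simp
    ring
  have h1 := hsq 1
  rw [Complex.ofReal_one] at h1
  have hnorm : ‖F + l • (1 : C(K, ℂ))‖ = ‖l + 1‖ := by
    refine le_antisymm ((ContinuousMap.norm_le _ (norm_nonneg _)).2 fun x => ?_) ?_
    · refine le_of_sq_le_sq ?_ (norm_nonneg _)
      rw [hval, hsq, h1]
      obtain ⟨h2, h3⟩ := hF01 x
      nlinarith [mul_le_mul_of_nonneg_right h3 hl]
    · obtain ⟨x, hx⟩ := hF1
      have := (F + l • (1 : C(K, ℂ))).norm_coe_le_norm x
      rwa [hval, hx, Complex.ofReal_one] at this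
  refine ⟨hnorm, fun x hx => ?_⟩
  have hre : (F x).re = 1 := by
    rw [hnorm, hval] at hx
    have h2 := congrArg (· ^ 2) hx
    simp only [h1, hsq] at h2
    obtain ⟨h3, h4⟩ := hF01 x
    nlinarith [mul_le_mul_of_nonneg_right h4 hl]
  exact ⟨hre, Complex.ext (by simp [hre]) (by simp [hFim])⟩

variable {K₁ K₂ : Type*}
  [TopologicalSpace K₁] [CompactSpace K₁] [Nonempty K₁]
  [TopologicalSpace K₂] [CompactSpace K₂]
  {A₁ : Subalgebra ℂ C(K₁, ℂ)} {A₂ : Subalgebra ℂ C(K₂, ℂ)}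
  {d₁ : Seminorm ℂ A₁} {d₂ : Seminorm ℂ A₂} (U : A₁ ≃ₗ[ℂ] A₂)
  (hiso : ∀ F, ‖(U F : C(K₂, ℂ))‖ + d₂ (U F) = ‖(F : C(K₁, ℂ))‖ + d₁ F)
  (hd₁ : d₁ 1 = 0) (hd₂ : d₂ 1 = 0)

include hiso hd₁

theorem norm_add_seminorm_map_one : ‖(U 1 : C(K₂, ℂ))‖ + d₂ (U 1) = 1 := by
  rw [hiso, hd₁, add_zero]
  exact norm_one

theorem norm_map_one_pos : 0 < ‖(U 1 : C(K₂, ℂ))‖ := by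
  rw [norm_pos_iff]
  intro h
  have h0 : U 1 = 0 := Subtype.ext h
  have h1 := norm_add_seminorm_map_one U hiso hd₁
  have h2 := map_smul_eq_mul d₂ (0 : ℂ) 0
  rw [zero_smul, norm_zero, zero_mul] at h2
  rw [h, h0, h2, norm_zero, add_zero] at h1
  exact zero_ne_one h1

variable [Nonempty K₂]

/-- Put a = U⁻¹G, z = a(q). Moving a by tz·1 raises its sup norm at rate at least ‖a‖ and leaves d₁
fixed. On the other side d₂ absorbs at most the rate ‖a‖(1 - ‖v‖), where v = U 1, so ‖G + tzv‖ grows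
at rate at least ‖a‖‖v‖. That is the largest rate possible, and equality fixes both modulus and
phase at some norming point. -/
theorem exists_phase {G : A₂} (hG : (G : C(K₂, ℂ)) ≠ 0) {q : K₁}
    (hq : ‖(U.symm G : C(K₁, ℂ)) q‖ = ‖(U.symm G : C(K₁, ℂ))‖) :
    ∃ p, ‖(G : C(K₂, ℂ)) p‖ = ‖(G : C(K₂, ℂ))‖ ∧
      ‖(U 1 : C(K₂, ℂ)) p‖ = ‖(U 1 : C(K₂, ℂ))‖ ∧
      starRingEnd ℂ ((U.symm G : C(K₁, ℂ)) q) * ((‖(G : C(K₂, ℂ))‖ * ‖(U 1 : C(K₂, ℂ))‖ : ℝ) : ℂ)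
        = ‖(U.symm G : C(K₁, ℂ))‖ * (starRingEnd ℂ ((G : C(K₂, ℂ)) p) * (U 1 : C(K₂, ℂ)) p) := by
  have hv := norm_add_seminorm_map_one U hiso hd₁
  have hc := norm_map_one_pos U hiso hd₁
  obtain ⟨a, rfl⟩ := U.surjective G
  rw [U.symm_apply_apply] at hq ⊢
  have ha : (a : C(K₁, ℂ)) ≠ 0 := by
    intro h
    have h0 : a = 0 := Subtype.ext h
    exact hG (by rw [h0, map_zero]; rfl)
  have hapos := norm_pos_iff.2 ha
  have hGpos := norm_pos_iff.2 hG
  set z := (a : C(K₁, ℂ)) q with hz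
  have key : ∀ t : ℝ, 0 ≤ t → ‖(U a : C(K₂, ℂ))‖ + t * (‖(a : C(K₁, ℂ))‖ * ‖(U 1 : C(K₂, ℂ))‖) ≤
      ‖(U a : C(K₂, ℂ)) + (t : ℂ) • (z • (U 1 : C(K₂, ℂ)))‖ := by
    intro t ht
    have h1 := le_norm_add_smul ha (z • (1 : C(K₁, ℂ))) hq t
    have h2 : (starRingEnd ℂ z * (z • (1 : C(K₁, ℂ))) q).re / ‖(a : C(K₁, ℂ))‖
        = ‖(a : C(K₁, ℂ))‖ := by
      have : (starRingEnd ℂ z * (z • (1 : C(K₁, ℂ))) q).re = ‖z‖ ^ 2 := by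
        rw [Complex.sq_norm, Complex.normSq_apply]
        simp
      rw [this, hq, sq, mul_div_assoc, div_self hapos.ne', mul_one]
    rw [h2] at h1
    have h3 := hiso (a + (t : ℂ) • (z • (1 : A₁)))
    rw [smul_smul, d₁.map_add_smul_of_eq_zero hd₁, map_add, map_smul] at h3
    have h4 : d₂ (U a + ((t : ℂ) * z) • U 1) ≤ d₂ (U a) + t * ‖(a : C(K₁, ℂ))‖ * d₂ (U 1) := by
      refine (map_add_le_add d₂ _ _).trans ?_
      rw [map_smul_eq_mul, norm_mul, hq, Complex.norm_real, Real.norm_of_nonneg ht]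
    have h5 := hiso a
    rw [smul_smul] at h1 ⊢
    have h6 : ((a + ((t : ℂ) * z) • (1 : A₁) : A₁) : C(K₁, ℂ))
        = (a : C(K₁, ℂ)) + ((t : ℂ) * z) • (1 : C(K₁, ℂ)) := rfl
    have h7 : ((U a + ((t : ℂ) * z) • U 1 : A₂) : C(K₂, ℂ))
        = (U a : C(K₂, ℂ)) + ((t : ℂ) * z) • (U 1 : C(K₂, ℂ)) := rfl
    rw [h6, h7] at h3
    have h8 : d₂ (U 1) = 1 - ‖(U 1 : C(K₂, ℂ))‖ := by linarith
    rw [h8] at h4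
    linarith
  obtain ⟨p, hp, hle⟩ : ∃ p, ‖(U a : C(K₂, ℂ)) p‖ = ‖(U a : C(K₂, ℂ))‖ ∧
      ‖(a : C(K₁, ℂ))‖ * ‖(U 1 : C(K₂, ℂ))‖ * ‖(U a : C(K₂, ℂ))‖ ≤
        (starRingEnd ℂ ((U a : C(K₂, ℂ)) p) * (z • (U 1 : C(K₂, ℂ))) p).re := by
    by_contra! hcon
    obtain ⟨t, ht, ht0⟩ := ((eventually_norm_add_smul_lt hG _ hcon).and
      self_mem_nhdsWithin).exists
    exact absurd (key t (le_of_lt ht0)) (not_le.2 ht)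
  have hvp := (U 1 : C(K₂, ℂ)).norm_coe_le_norm p
  have heq := Complex.eq_ofReal_of_norm_le_of_le_re (z := starRingEnd ℂ ((U a : C(K₂, ℂ)) p) *
      (z • (U 1 : C(K₂, ℂ))) p) (r := ‖(a : C(K₁, ℂ))‖ * ‖(U 1 : C(K₂, ℂ))‖ * ‖(U a : C(K₂, ℂ))‖)
    (by
      rw [norm_mul, RCLike.norm_conj, ContinuousMap.smul_apply, norm_smul, hp, hq, mul_comm]
      gcongr) hle
  rw [ContinuousMap.smul_apply, smul_eq_mul] at heq
  have hnorm := congrArg norm heq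
  rw [norm_mul, norm_mul, RCLike.norm_conj, hp, hq, Complex.norm_real,
    Real.norm_of_nonneg (by positivity)] at hnorm
  have hvpeq : ‖(U 1 : C(K₂, ℂ)) p‖ = ‖(U 1 : C(K₂, ℂ))‖ := by
    have : (‖(U a : C(K₂, ℂ))‖ * ‖(a : C(K₁, ℂ))‖) * ‖(U 1 : C(K₂, ℂ)) p‖
        = (‖(U a : C(K₂, ℂ))‖ * ‖(a : C(K₁, ℂ))‖) * ‖(U 1 : C(K₂, ℂ))‖ := by linarith
    exact mul_left_cancel₀ (by positivity) this
  refine ⟨p, hp, hvpeq, ?_⟩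
  have hconj := congrArg (starRingEnd ℂ) heq
  rw [map_mul, map_mul, Complex.conj_conj, Complex.conj_ofReal] at hconj
  have e1 : (U a : C(K₂, ℂ)) p * starRingEnd ℂ ((U a : C(K₂, ℂ)) p)
      = ((‖(U a : C(K₂, ℂ))‖ : ℝ) : ℂ) ^ 2 := by
    rw [Complex.mul_conj', hp]
  have e2 : (U 1 : C(K₂, ℂ)) p * starRingEnd ℂ ((U 1 : C(K₂, ℂ)) p)
      = ((‖(U 1 : C(K₂, ℂ))‖ : ℝ) : ℂ) ^ 2 := by
    rw [Complex.mul_conj', hvpeq]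
  have hne : (((‖(U a : C(K₂, ℂ))‖ * ‖(U 1 : C(K₂, ℂ))‖ : ℝ)) : ℂ) ≠ 0 := by
    exact_mod_cast (mul_pos hGpos hc).ne'
  apply mul_left_cancel₀ hne
  push_cast at hconj ⊢
  linear_combination (starRingEnd ℂ ((U a : C(K₂, ℂ)) p) * (U 1 : C(K₂, ℂ)) p) * hconj
    - starRingEnd ℂ z * ((U 1 : C(K₂, ℂ)) p * starRingEnd ℂ ((U 1 : C(K₂, ℂ)) p)) * e1
    - starRingEnd ℂ z * ((‖(U a : C(K₂, ℂ))‖ : ℝ) : ℂ) ^ 2 * e2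

variable [T2Space K₂] (hsep : A₂.SeparatesPoints) (hstar : ∀ f ∈ A₂, star f ∈ A₂)

include hsep hstar in
-- For F peaking near p, all norming points of F + 1 lie near p, and |v| is maximal at one of them.
theorem norm_map_one_apply (p : K₂) : ‖(U 1 : C(K₂, ℂ)) p‖ = ‖(U 1 : C(K₂, ℂ))‖ := by
  refine le_antisymm ((U 1 : C(K₂, ℂ)).norm_coe_le_norm p) (le_of_forall_pos_lt_add fun ε hε => ?_)
  obtain ⟨F, hF, hFim, hF01, hF1, hFW⟩ := exists_peak hsep hstar
    (W := {x | ‖(U 1 : C(K₂, ℂ)) x - (U 1 : C(K₂, ℂ)) p‖ < ε})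
    (isOpen_lt (by fun_prop) continuous_const) (p := p) (by simpa using hε)
  obtain ⟨hn, hpk⟩ := norm_const_add_eq hFim hF01 hF1 (l := 1) (by simp)
  let G : A₂ := ⟨F, hF⟩ + (1 : ℂ) • 1
  have hG : (G : C(K₂, ℂ)) = F + (1 : ℂ) • (1 : C(K₂, ℂ)) := rfl
  have hG0 : (G : C(K₂, ℂ)) ≠ 0 := by
    rw [hG, ← norm_pos_iff, hn]
    norm_num
  obtain ⟨q, hq⟩ := exists_norm_eq_norm (U.symm G : C(K₁, ℂ))
  obtain ⟨x, hx, hvx, -⟩ := exists_phase U hiso hd₁ hG0 hq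
  have hxW : ‖(U 1 : C(K₂, ℂ)) x - (U 1 : C(K₂, ℂ)) p‖ < ε := hFW x (hpk x (hG ▸ hx)).1
  have := norm_sub_norm_le ((U 1 : C(K₂, ℂ)) x) ((U 1 : C(K₂, ℂ)) p)
  linarith

include hd₂ hsep hstar in
-- Let F peak near p and compare F + 1 with F + l. In direction zv both have the same seminorm
-- before and after perturbation, so the difference of their sup-norm derivatives agrees with the
-- one for their preimages in direction z. By `exists_phase` the latter carries a factor 1/c: up to
-- ε, X = X/c.
theorem one_le_norm_map_one : 1 ≤ ‖(U 1 : C(K₂, ℂ))‖ := by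
  obtain ⟨p⟩ := ‹Nonempty K₂›
  have hvp := norm_map_one_apply U hiso hd₁ hsep hstar p
  have hc := norm_map_one_pos U hiso hd₁
  set v : C(K₂, ℂ) := (U 1 : C(K₂, ℂ)) with hv
  set c := ‖v‖ with hcdef
  -- The conjugate phase of 1 + l = 1 + 4i/3, the peak value of F + l; the 3-4-5 triple keeps moduli
  -- rational. The choice of z makes (1 - ub)·z·v(p) a positive number X.
  set ub : ℂ := (3 - 4 * Complex.I) / 5 with hub
  set z : ℂ := starRingEnd ℂ (v p * (1 - ub)) with hz
  have hvp0 : v p * (1 - ub) ≠ 0 := by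
    refine mul_ne_zero (norm_pos_iff.1 (hvp ▸ hc)) fun h => ?_
    have := congrArg Complex.im h
    simp [hub] at this
  set X : ℝ := ‖v p * (1 - ub)‖ ^ 2 with hX
  have hXpos : 0 < X := by
    have := norm_pos_iff.2 hvp0
    positivity
  have hXre : (z * v p).re - (ub * (z * v p)).re = X := by
    have : z * v p - ub * (z * v p) = (X : ℂ) := by
      rw [hX, Complex.ofReal_pow, ← Complex.conj_mul']
      ring
    rw [← Complex.sub_re, this, Complex.ofReal_re]
  suffices h : ∀ ε > 0, X ≤ X * c + ε * (2 * ‖z‖ * c + 2 * ‖z‖ + 2 * c) by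
    have h1 : X ≤ X * c := by
      refine le_of_forall_pos_le_add fun δ hδ => ?_
      have hpos : 0 < 2 * ‖z‖ * c + 2 * ‖z‖ + 2 * c := by positivity
      have := h (δ / (2 * ‖z‖ * c + 2 * ‖z‖ + 2 * c)) (by positivity)
      rwa [div_mul_cancel₀ _ hpos.ne'] at this
    exact le_of_mul_le_mul_left (by linarith) hXpos
  intro ε hε
  obtain ⟨F, hF, hFim, hF01, hF1, hFW⟩ := exists_peak hsep hstar
    (W := {x | ‖v x - v p‖ < ε}) (isOpen_lt (by fun_prop) continuous_const) (p := p)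
    (by simpa using hε)
  set l : ℂ := 4 / 3 * Complex.I with hl
  obtain ⟨hn, hpk⟩ := norm_const_add_eq hFim hF01 hF1 (l := 1) (by simp)
  obtain ⟨hn', hpk'⟩ := norm_const_add_eq hFim hF01 hF1 (l := l) (by simp [hl])
  have hnn : ‖(1 : ℂ) + 1‖ = 2 := by norm_num
  have hnn' : ‖l + 1‖ = 5 / 3 := by
    rw [← sq_eq_sq₀ (norm_nonneg _) (by norm_num), Complex.sq_norm, Complex.normSq_apply]
    simp [hl]
    norm_num
  rw [hnn] at hn
  rw [hnn'] at hn'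
  let G : A₂ := ⟨F, hF⟩ + (1 : ℂ) • 1
  let G' : A₂ := ⟨F, hF⟩ + l • 1
  have hG : (G : C(K₂, ℂ)) = F + (1 : ℂ) • (1 : C(K₂, ℂ)) := rfl
  have hG' : (G' : C(K₂, ℂ)) = F + l • (1 : C(K₂, ℂ)) := rfl
  rw [← hG] at hn hpk
  rw [← hG'] at hn' hpk'
  have hG0 : (G : C(K₂, ℂ)) ≠ 0 := by
    rw [← norm_pos_iff, hn]
    norm_num
  have hG0' : (G' : C(K₂, ℂ)) ≠ 0 := by
    rw [← norm_pos_iff, hn']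
    norm_num
  have hsymm0 : ∀ H : A₂, (H : C(K₂, ℂ)) ≠ 0 → (U.symm H : C(K₁, ℂ)) ≠ 0 := fun H hH h => by
    have h1 : U.symm H = 0 := Subtype.ext h
    rw [LinearEquiv.map_eq_zero_iff] at h1
    exact hH (by rw [h1]; rfl)
  have hGval : ∀ x, ‖(G : C(K₂, ℂ)) x‖ = ‖(G : C(K₂, ℂ))‖ → (G : C(K₂, ℂ)) x = 2 := fun x hx => by
    have h1 := (hpk x hx).2
    rw [hG]
    simp [h1]
    norm_num
  have hGval' : ∀ x, ‖(G' : C(K₂, ℂ)) x‖ = ‖(G' : C(K₂, ℂ))‖ →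
      starRingEnd ℂ ((G' : C(K₂, ℂ)) x) = 5 / 3 * ub := fun x hx => by
    have h1 := (hpk' x hx).2
    rw [hG']
    simp [h1, hl, hub]
    rw [Complex.conj_ofNat, Complex.conj_ofNat]
    ring
  have hub1 : ‖ub‖ = 1 := by
    rw [← sq_eq_sq₀ (norm_nonneg _) (by norm_num), Complex.sq_norm, Complex.normSq_apply]
    simp [hub]
    norm_num
  -- near the peak set, `v` is close to its value at `p`
  have hclose : ∀ (s : ℂ), ‖s‖ = 1 → ∀ x, ‖v x - v p‖ < ε →
      |(s * (z * v x)).re - (s * (z * v p)).re| ≤ ε * ‖z‖ := by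
    intro s hs x hx
    rw [← Complex.sub_re]
    refine (Complex.abs_re_le_norm _).trans ?_
    rw [show s * (z * v x) - s * (z * v p) = s * (z * (v x - v p)) by ring, norm_mul, norm_mul, hs,
      one_mul, mul_comm]
    gcongr
  set a := U.symm G with ha
  set a' := U.symm G' with ha'
  have hcne : (c : ℂ) ≠ 0 := by exact_mod_cast hc.ne'
  -- the four estimates
  have e1 : ∀ᶠ t : ℝ in 𝓝[>] 0, ‖(G : C(K₂, ℂ)) + (t : ℂ) • (z • v)‖
      < ‖(G : C(K₂, ℂ))‖ + t * ((z * v p).re + ε * ‖z‖ + ε) := by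
    refine eventually_norm_add_smul_lt hG0 _ fun x hx => ?_
    rw [hGval x hx, hn]
    have h1 := (abs_le.1 (hclose 1 norm_one x (hFW x (hpk x hx).1))).2
    simp only [one_mul] at h1
    have h2 : (starRingEnd ℂ (2 : ℂ) * (z • v) x).re = 2 * (z * v x).re := by
      rw [Complex.conj_ofNat]
      simp
    rw [h2]
    linarith
  obtain ⟨q, hq⟩ := exists_norm_eq_norm (a : C(K₁, ℂ))
  have hphase : ∀ {H : A₂} (hH : (H : C(K₂, ℂ)) ≠ 0) {q : K₁}
      (hq : ‖(U.symm H : C(K₁, ℂ)) q‖ = ‖(U.symm H : C(K₁, ℂ))‖),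
      ∃ x, ‖(H : C(K₂, ℂ)) x‖ = ‖(H : C(K₂, ℂ))‖ ∧
      (starRingEnd ℂ ((U.symm H : C(K₁, ℂ)) q) * z).re * (‖(H : C(K₂, ℂ))‖ * c)
        = ‖(U.symm H : C(K₁, ℂ))‖ * (starRingEnd ℂ ((H : C(K₂, ℂ)) x) * (z * v x)).re := by
    intro H hH q hq
    obtain ⟨x, hx, -, hxq⟩ := exists_phase U hiso hd₁ hH hq
    refine ⟨x, hx, ?_⟩
    have h1 := congrArg (fun w => (w * z).re) hxq
    rw [← Complex.re_mul_ofReal, ← Complex.re_ofReal_mul]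
    convert h1 using 2 <;> ring
  have e2 : ∀ t : ℝ, 0 ≤ t → ‖(a : C(K₁, ℂ))‖ + t * (((z * v p).re - ε * ‖z‖) / c)
      ≤ ‖(a : C(K₁, ℂ)) + (t : ℂ) • (z • (1 : C(K₁, ℂ)))‖ := by
    intro t ht
    obtain ⟨x, hx, hxq⟩ := hphase hG0 hq
    refine le_trans ?_ (le_norm_add_smul (hsymm0 G hG0) (z • (1 : C(K₁, ℂ))) hq t)
    have h1 := (abs_le.1 (hclose 1 norm_one x (hFW x (hpk x hx).1))).1
    simp only [one_mul] at h1
    have h2 : (starRingEnd ℂ (2 : ℂ) * (z * v x)).re = 2 * (z * v x).re := by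
      rw [Complex.conj_ofNat]
      simp
    rw [hGval x hx, hn, h2, ← ha] at hxq
    have hapos : 0 < ‖(a : C(K₁, ℂ))‖ := norm_pos_iff.2 (hsymm0 G hG0)
    have h3 : (starRingEnd ℂ ((a : C(K₁, ℂ)) q) * (z • (1 : C(K₁, ℂ))) q).re / ‖(a : C(K₁, ℂ))‖
        = (z * v x).re / c := by
      rw [div_eq_div_iff hapos.ne' hc.ne', ContinuousMap.smul_apply, ContinuousMap.one_apply,
        smul_eq_mul, mul_one]
      linarith
    rw [← ha, h3]
    gcongr
    linarith
  have e3 : ∀ᶠ t : ℝ in 𝓝[>] 0, ‖(a' : C(K₁, ℂ)) + (t : ℂ) • (z • (1 : C(K₁, ℂ)))‖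
      < ‖(a' : C(K₁, ℂ))‖ + t * (((ub * (z * v p)).re + ε * ‖z‖) / c + ε) := by
    refine eventually_norm_add_smul_lt (hsymm0 G' hG0') _ fun q hq => ?_
    obtain ⟨x, hx, hxq⟩ := hphase hG0' hq
    have h1 := (abs_le.1 (hclose ub hub1 x (hFW x (hpk' x hx).1))).2
    have h2 : (5 / 3 * ub * (z * v x)).re = 5 / 3 * (ub * (z * v x)).re := by
      rw [mul_assoc, ← Complex.re_ofReal_mul]
      norm_num
    rw [hGval' x hx, hn', h2] at hxq
    have hapos : 0 < ‖(a' : C(K₁, ℂ))‖ := norm_pos_iff.2 (hsymm0 G' hG0')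
    rw [← ha'] at hxq
    have h3 : (starRingEnd ℂ ((a' : C(K₁, ℂ)) q) * (z • (1 : C(K₁, ℂ))) q).re
        = (ub * (z * v x)).re / c * ‖(a' : C(K₁, ℂ))‖ := by
      rw [div_mul_eq_mul_div, eq_div_iff hc.ne', ContinuousMap.smul_apply, ContinuousMap.one_apply,
        smul_eq_mul, mul_one]
      linarith
    rw [h3]
    refine mul_lt_mul_of_pos_right ?_ hapos
    have h4 : (ub * (z * v x)).re / c ≤ ((ub * (z * v p)).re + ε * ‖z‖) / c := by
      gcongr
      linarith
    linarith
  obtain ⟨q', hq'⟩ := exists_norm_eq_norm (a' : C(K₁, ℂ))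
  obtain ⟨x', hx', -⟩ := hphase hG0' hq'
  have e4 : ∀ t : ℝ, 0 ≤ t → ‖(G' : C(K₂, ℂ))‖ + t * ((ub * (z * v p)).re - ε * ‖z‖)
      ≤ ‖(G' : C(K₂, ℂ)) + (t : ℂ) • (z • v)‖ := by
    intro t ht
    refine le_trans ?_ (le_norm_add_smul hG0' (z • v) hx' t)
    have h1 := (abs_le.1 (hclose ub hub1 x' (hFW x' (hpk' x' hx').1))).1
    have h2 : (5 / 3 * ub * (z * v x')).re = 5 / 3 * (ub * (z * v x')).re := by
      rw [mul_assoc, ← Complex.re_ofReal_mul]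
      norm_num
    have h3 : (starRingEnd ℂ ((G' : C(K₂, ℂ)) x') * (z • v) x').re / ‖(G' : C(K₂, ℂ))‖
        = (ub * (z * v x')).re := by
      rw [hGval' x' hx', ContinuousMap.smul_apply, smul_eq_mul, h2, hn']
      ring
    rw [h3]
    gcongr
    linarith
  obtain ⟨t, ⟨ht1, ht3⟩, ht0⟩ := ((e1.and e3).and self_mem_nhdsWithin).exists
  have ht0 : 0 < t := ht0
  have ht2 := e2 t ht0.le
  have ht4 := e4 t ht0.le
  -- comparison of the norms on both sides
  have hcmp : ∀ H : A₂, ‖(H : C(K₂, ℂ)) + (t : ℂ) • (z • v)‖ + d₂ (H + ((t : ℂ) * z) • U 1)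
      = ‖(U.symm H : C(K₁, ℂ)) + (t : ℂ) • (z • (1 : C(K₁, ℂ)))‖
        + (‖(H : C(K₂, ℂ))‖ + d₂ H - ‖(U.symm H : C(K₁, ℂ))‖) := by
    intro H
    have h1 := hiso (U.symm H + ((t : ℂ) * z) • (1 : A₁))
    rw [d₁.map_add_smul_of_eq_zero hd₁, map_add, map_smul, U.apply_symm_apply] at h1
    have h2 := hiso (U.symm H)
    rw [U.apply_symm_apply] at h2
    have h6 : ((U.symm H + ((t : ℂ) * z) • (1 : A₁) : A₁) : C(K₁, ℂ))
        = (U.symm H : C(K₁, ℂ)) + ((t : ℂ) * z) • (1 : C(K₁, ℂ)) := rfl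
    have h7 : ((H + ((t : ℂ) * z) • U 1 : A₂) : C(K₂, ℂ))
        = (H : C(K₂, ℂ)) + ((t : ℂ) * z) • v := rfl
    rw [h6, h7] at h1
    rw [smul_smul, smul_smul]
    linarith
  have hcG := hcmp G
  have hcG' := hcmp G'
  have hdd : ∀ s : ℂ, d₂ (⟨F, hF⟩ + s • 1 + ((t : ℂ) * z) • U 1)
      = d₂ (⟨F, hF⟩ + ((t : ℂ) * z) • U 1) := fun s => by
    rw [add_right_comm, d₂.map_add_smul_of_eq_zero hd₂]
  have hdd1 : d₂ (G + ((t : ℂ) * z) • U 1) = d₂ (G' + ((t : ℂ) * z) • U 1) :=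
    (hdd 1).trans (hdd l).symm
  have hdd2 : d₂ G = d₂ G' :=
    (d₂.map_add_smul_of_eq_zero hd₂ _ 1).trans (d₂.map_add_smul_of_eq_zero hd₂ _ l).symm
  rw [← ha] at hcG
  rw [← ha'] at hcG'
  have hfin : t * (((z * v p).re - ε * ‖z‖) / c - (((ub * (z * v p)).re + ε * ‖z‖) / c + ε))
      < t * (((z * v p).re + ε * ‖z‖ + ε) - ((ub * (z * v p)).re - ε * ‖z‖)) := by
    linarith
  have hfin := lt_of_mul_lt_mul_left hfin ht0.le
  have h5 : ((z * v p).re - ε * ‖z‖) / c - (((ub * (z * v p)).re + ε * ‖z‖) / c + ε)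
      = (X - 2 * ε * ‖z‖) / c - ε := by
    rw [← hXre]
    ring
  rw [h5, sub_lt_iff_lt_add, div_lt_iff₀ hc] at hfin
  have h6 : (z * v p).re + ε * ‖z‖ + ε - ((ub * (z * v p)).re - ε * ‖z‖) + ε
      = X + 2 * ε * ‖z‖ + 2 * ε := by
    rw [← hXre]
    ring
  rw [h6] at hfin
  linarith

end UnitImage

/-! ### Unital isometries are composition operators. -/

section Unital

theorem maxRe_smul_of_real {K : Type*} [TopologicalSpace K] {F : C(K, ℂ)}
    (hF : ∀ x, (F x).im = 0) {z : ℂ} (hz : 0 ≤ z.re) : maxRe (z • F) = z.re * maxRe F := by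
  simp only [maxRe]
  rw [Real.mul_iSup_of_nonneg hz]
  simp [hF]

/-- For real F and Re z > 0, Re(zF) is maximal exactly where F is, so the derivative, the maximum κ
of Re w there, does not depend on z. -/
theorem exists_maxRe_derivative_of_real {K : Type*} [TopologicalSpace K] [CompactSpace K]
    [Nonempty K] {F : C(K, ℂ)} (hF : ∀ x, (F x).im = 0) (w : C(K, ℂ)) :
    ∃ κ : ℝ, ∀ z : ℂ, 0 < z.re →
      (∀ t : ℝ, z.re * maxRe F + t * κ ≤ maxRe (z • F + (t : ℂ) • w)) ∧
      ∀ δ > 0, ∀ᶠ t : ℝ in 𝓝[>] 0,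
        maxRe (z • F + (t : ℂ) • w) < z.re * maxRe F + t * (κ + δ) := by
  have hcl : IsClosed {x | (F x).re = maxRe F} :=
    isClosed_eq (Complex.continuous_re.comp F.continuous) continuous_const
  obtain ⟨p, hp, hpmax⟩ := hcl.isCompact.exists_isMaxOn (exists_re_eq_maxRe F)
    (Complex.continuous_re.comp w.continuous).continuousOn
  refine ⟨(w p).re, fun z hz => ⟨fun t => ?_, fun δ hδ => ?_⟩⟩
  · rw [← maxRe_smul_of_real hF hz.le]
    refine le_maxRe_add_smul w ?_ t
    rw [maxRe_smul_of_real hF hz.le, ← show (F p).re = maxRe F from hp]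
    simp [hF]
  · rw [← maxRe_smul_of_real hF hz.le]
    refine eventually_maxRe_add_smul_lt _ w fun x hx => ?_
    rw [maxRe_smul_of_real hF hz.le] at hx
    have h1 : z.re * (F x).re = z.re * maxRe F := by
      rw [← hx]
      simp [hF]
    have h2 : (w x).re ≤ (w p).re := hpmax (mul_left_cancel₀ hz.ne' h1)
    linarith

/-- By compactness the evaluations embed K as a closed subset of a power of ℂ, so K carries the weak
topology of A. -/
theorem Subalgebra.SeparatesPoints.continuous_of_comp {K T : Type*} [TopologicalSpace K]
    [CompactSpace K] [TopologicalSpace T] {A : Subalgebra ℂ C(K, ℂ)} (hsep : A.SeparatesPoints)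
    {σ : T → K} (hσ : ∀ F : A, Continuous fun p => (F : C(K, ℂ)) (σ p)) : Continuous σ := by
  let ev : K → A → ℂ := fun x F => (F : C(K, ℂ)) x
  have hev : Continuous ev := continuous_pi fun F => (F : C(K, ℂ)).continuous
  have hinj : Function.Injective ev := by
    intro x y hxy
    by_contra hne
    obtain ⟨f, ⟨f, hf, rfl⟩, hfne⟩ := hsep hne
    exact hfne (congrFun hxy ⟨f, hf⟩)
  exact (hev.isClosedEmbedding hinj).isInducing.continuous_iff.2 (continuous_pi hσ)

variable {K₁ K₂ : Type*}
  [TopologicalSpace K₁] [CompactSpace K₁]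
  [TopologicalSpace K₂] [CompactSpace K₂]
  {A₁ : Subalgebra ℂ C(K₁, ℂ)} {A₂ : Subalgebra ℂ C(K₂, ℂ)}
  {d₁ : Seminorm ℂ A₁} {d₂ : Seminorm ℂ A₂}

theorem isometry_symm {U : A₁ ≃ₗ[ℂ] A₂}
    (hiso : ∀ F, ‖(U F : C(K₂, ℂ))‖ + d₂ (U F) = ‖(F : C(K₁, ℂ))‖ + d₁ F) (G : A₂) :
    ‖(U.symm G : C(K₁, ℂ))‖ + d₁ (U.symm G) = ‖(G : C(K₂, ℂ))‖ + d₂ G := by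
  rw [← hiso, U.apply_symm_apply]

variable [Nonempty K₁] [Nonempty K₂]

theorem maxRe_add_seminorm_le (U : A₁ ≃ₗ[ℂ] A₂)
    (hiso : ∀ F, ‖(U F : C(K₂, ℂ))‖ + d₂ (U F) = ‖(F : C(K₁, ℂ))‖ + d₁ F)
    (hd₁ : d₁ 1 = 0) (hd₂ : d₂ 1 = 0) (hU1 : U 1 = 1) (F : A₁) :
    maxRe (U F : C(K₂, ℂ)) + d₂ (U F) ≤ maxRe (F : C(K₁, ℂ)) + d₁ F := by
  refine le_of_forall_pos_lt_add fun δ hδ => ?_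
  obtain ⟨t, ht, ht0⟩ := ((eventually_norm_add_smul_lt (one_ne_zero : (1 : C(K₁, ℂ)) ≠ 0) (F : C(K₁, ℂ))
    (α := maxRe (F : C(K₁, ℂ)) + δ) (fun x _ => by
      have := re_le_maxRe (F : C(K₁, ℂ)) x
      simp only [ContinuousMap.one_apply, map_one, one_mul, norm_one, mul_one]
      linarith)).and self_mem_nhdsWithin).exists
  have ht0 : 0 < t := ht0
  obtain ⟨p, hp⟩ := exists_re_eq_maxRe (U F : C(K₂, ℂ))
  have h1 := le_norm_add_smul (one_ne_zero : (1 : C(K₂, ℂ)) ≠ 0) (U F : C(K₂, ℂ)) (x := p)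
    (by simp) t
  simp only [ContinuousMap.one_apply, map_one, one_mul, norm_one, div_one, hp] at h1
  rw [norm_one] at ht
  have h2 := hiso ((t : ℂ) • F + (1 : ℂ) • 1)
  rw [d₁.map_add_smul_of_eq_zero hd₁, map_add, map_smul, map_smul, hU1,
    d₂.map_add_smul_of_eq_zero hd₂, map_smul_eq_mul, map_smul_eq_mul, Complex.norm_real,
    Real.norm_of_nonneg ht0.le, one_smul, one_smul] at h2
  have h3 : (((t : ℂ) • F + 1 : A₁) : C(K₁, ℂ)) = 1 + (t : ℂ) • (F : C(K₁, ℂ)) := add_comm _ _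
  have h4 : (((t : ℂ) • U F + 1 : A₂) : C(K₂, ℂ)) = 1 + (t : ℂ) • (U F : C(K₂, ℂ)) := add_comm _ _
  rw [h3, h4] at h2
  have h5 : t * (maxRe (U F : C(K₂, ℂ)) + d₂ (U F)) < t * (maxRe (F : C(K₁, ℂ)) + d₁ F + δ) := by
    linarith
  exact lt_of_mul_lt_mul_left h5 ht0.le

variable (U : A₁ ≃ₗ[ℂ] A₂)
  (hiso : ∀ F, ‖(U F : C(K₂, ℂ))‖ + d₂ (U F) = ‖(F : C(K₁, ℂ))‖ + d₁ F)
  (hd₁ : d₁ 1 = 0) (hd₂ : d₂ 1 = 0) (hU1 : U 1 = 1)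

include hiso hd₁ hd₂ hU1

theorem maxRe_add_seminorm_eq (F : A₁) :
    maxRe (U F : C(K₂, ℂ)) + d₂ (U F) = maxRe (F : C(K₁, ℂ)) + d₁ F := by
  refine le_antisymm (maxRe_add_seminorm_le U hiso hd₁ hd₂ hU1 F) ?_
  have := maxRe_add_seminorm_le U.symm (isometry_symm hiso) hd₂ hd₁
    (by rw [← hU1, U.symm_apply_apply]) (U F)
  rwa [U.symm_apply_apply] at this

theorem maxRe_smul_add_seminorm_eq (F : A₁) {z : ℂ} (hz : ‖z‖ = 1) :
    maxRe (z • (U F : C(K₂, ℂ))) + d₂ (U F) = maxRe (z • (F : C(K₁, ℂ))) + d₁ F := by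
  have h := maxRe_add_seminorm_eq U hiso hd₁ hd₂ hU1 (z • F)
  rw [map_smul, map_smul_eq_mul, map_smul_eq_mul, hz, one_mul, one_mul] at h
  exact h

variable [T2Space K₂] (hsep : A₂.SeparatesPoints) (hstar : ∀ f ∈ A₂, star f ∈ A₂)

include hsep hstar

/-- If r = d₁(F) - d₂(UF) > 0, then in all directions with Re z ≥ 0 the range of G = UF has the
support function of a disc of radius r about b = max F. Different directions then touch it at
different points, so a real w can give max Re(zG + tw) different derivatives for z₁ and z₂. On the F
side that derivative is κ₁ - κ₂ for both, because F is real. -/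
theorem seminorm_le_of_real {F : A₁} (hF : ∀ x, ((F : C(K₁, ℂ)) x).im = 0) :
    d₁ F ≤ d₂ (U F) := by
  by_contra! hlt
  have hdiff := fun (H : A₁) {z : ℂ} (hz : ‖z‖ = 1) =>
    maxRe_smul_add_seminorm_eq U hiso hd₁ hd₂ hU1 H hz
  obtain ⟨r, hr⟩ : ∃ r, r = d₁ F - d₂ (U F) := ⟨_, rfl⟩
  have hr0 : 0 < r := by linarith
  set b := maxRe (F : C(K₁, ℂ)) with hb
  set G : C(K₂, ℂ) := (U F : C(K₂, ℂ)) with hGdef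
  have hG : ∀ z : ℂ, ‖z‖ = 1 → 0 ≤ z.re → maxRe (z • G) = z.re * b + r := by
    intro z hz hz0
    have := hdiff F hz
    rw [maxRe_smul_of_real hF hz0] at this
    linarith
  have hunit : ∀ x y : ℝ, x ^ 2 + y ^ 2 = 1 → ‖(⟨x, y⟩ : ℂ)‖ = 1 := by
    intro x y hxy
    rw [← sq_eq_sq₀ (norm_nonneg _) zero_le_one, Complex.sq_norm, Complex.normSq_apply]
    linarith
  -- Rational unit vectors, z₃ between z₁ and z₂: z₃ is a positive combination of them with
  -- coefficient sum above 1, so a value of G touching the disc in directions z₁ and z₂ would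
  -- violate the bound for z₃.
  have hz1 := hunit (12 / 13) (-5 / 13) (by norm_num)
  have hz2 := hunit (5 / 13) (-12 / 13) (by norm_num)
  have hz3 := hunit (21 / 29) (-20 / 29) (by norm_num)
  have hG1 := hG _ hz1 (by norm_num)
  have hG2 := hG _ hz2 (by norm_num)
  have hG3 := hG _ hz3 (by norm_num)
  set z₁ : ℂ := ⟨12 / 13, -5 / 13⟩ with hz₁
  set z₂ : ℂ := ⟨5 / 13, -12 / 13⟩ with hz₂
  set z₃ : ℂ := ⟨21 / 29, -20 / 29⟩ with hz₃
  obtain ⟨q, hq⟩ := exists_re_eq_maxRe (z₁ • G)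
  have hQ : IsClosed {x | ((z₂ • G) x).re = maxRe (z₂ • G)} :=
    isClosed_eq (Complex.continuous_re.comp (z₂ • G).continuous) continuous_const
  have hqQ : q ∉ {x | ((z₂ • G) x).re = maxRe (z₂ • G)} := by
    intro hq2
    have hq2 : ((z₂ • G) q).re = maxRe (z₂ • G) := hq2
    have hq3 := re_le_maxRe (z₃ • G) q
    rw [hG1] at hq
    rw [hG2] at hq2
    rw [hG3] at hq3
    simp only [hz₁, hz₂, hz₃, ContinuousMap.smul_apply, smul_eq_mul, Complex.mul_re] at hq hq2 hq3
    linarith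
  obtain ⟨e, he0, he1, he⟩ := exists_continuous_zero_one_of_isClosed hQ
    (isClosed_singleton (x := q)) (Set.disjoint_singleton_right.2 hqQ)
  obtain ⟨w, hw, hwim, hwe⟩ := exists_real_near hsep hstar e (ε := 1 / 4) (by norm_num)
  have hwq : 3 / 4 < (w q).re := by
    have h1 := he1 (Set.mem_singleton q)
    have := abs_lt.1 (hwe q)
    simp only [Pi.one_apply] at h1
    linarith
  have hwQ : ∀ x, ((z₂ • G) x).re = maxRe (z₂ • G) → (w x).re < 1 / 4 := by
    intro x hx
    have h1 := he0 hx
    have := abs_lt.1 (hwe x)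
    simp only [Pi.zero_apply] at h1
    linarith
  set k := U.symm ⟨w, hw⟩ with hk
  obtain ⟨κ₁, hκ₁⟩ := exists_maxRe_derivative_of_real hF (k : C(K₁, ℂ))
  obtain ⟨κ₂, hκ₂⟩ := exists_maxRe_derivative_of_real hF (Complex.I • (k : C(K₁, ℂ)))
  -- the seminorms cancel when the directions `1` and `I` are compared
  have hmain : ∀ (z : ℂ) (t : ℝ), ‖z‖ = 1 → z.im ≤ 0 →
      maxRe (z • G + (t : ℂ) • w) = maxRe (z • (F : C(K₁, ℂ)) + (t : ℂ) • (k : C(K₁, ℂ)))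
        - maxRe ((Complex.I * z) • (F : C(K₁, ℂ)) + (t : ℂ) • (Complex.I • (k : C(K₁, ℂ))))
        + (-z.im * b + r) := by
    intro z t hz hz0
    have h1 := hdiff (z • F + (t : ℂ) • k) (z := 1) norm_one
    have h2 := hdiff (z • F + (t : ℂ) • k) (z := Complex.I) Complex.norm_I
    have h3 : (U (z • F + (t : ℂ) • k) : C(K₂, ℂ)) = z • G + (t : ℂ) • w := by
      rw [map_add, map_smul, map_smul, hk, U.apply_symm_apply]
      rfl
    have h4 : ((z • F + (t : ℂ) • k : A₁) : C(K₁, ℂ))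
        = z • (F : C(K₁, ℂ)) + (t : ℂ) • (k : C(K₁, ℂ)) := rfl
    rw [h3, h4, one_smul, one_smul] at h1
    rw [h3, h4] at h2
    -- As w is real, i·w has no real part, so this term does not move with t.
    have h5 : maxRe (Complex.I • (z • G + (t : ℂ) • w)) = maxRe ((Complex.I * z) • G) := by
      simp only [maxRe]
      simp [hwim, sub_eq_add_neg]
    have h6 := hG (Complex.I * z) (by rw [norm_mul, Complex.norm_I, hz, one_mul])
      (by simpa using hz0)
    have h7 : (Complex.I * z).re = -z.im := by simp
    rw [h5, h6, h7, smul_add, smul_smul, smul_comm Complex.I (t : ℂ)] at h2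
    linarith
  have hI : ∀ z : ℂ, (Complex.I * z).re = -z.im := fun z => by simp
  -- The two errors 1/8 stay below the gap 3/4 - 1/4 between the values of w.
  have e1 := (hκ₁ z₁ (by norm_num [hz₁])).2 (1 / 8) (by norm_num)
  have e2 := (hκ₂ (Complex.I * z₂) (by norm_num [hz₂])).2 (1 / 8) (by norm_num)
  have e3 := eventually_maxRe_add_smul_lt (z₂ • G) w hwQ
  obtain ⟨t, ⟨⟨ht1, ht2⟩, ht3⟩, ht0⟩ := (((e1.and e2).and e3).and self_mem_nhdsWithin).exists
  have ht0 : 0 < t := ht0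
  have l1 := (hκ₁ z₂ (by norm_num [hz₂])).1 t
  have l2 := (hκ₂ (Complex.I * z₁) (by norm_num [hz₁])).1 t
  have l3 := le_maxRe_add_smul w hq t
  have m1 := hmain z₁ t hz1 (by norm_num [hz₁])
  have m2 := hmain z₂ t hz2 (by norm_num [hz₂])
  rw [hI, ← hb] at ht2 l2
  rw [← hb] at ht1 l1
  rw [hG1] at l3
  rw [hG2] at ht3
  have h8 := mul_lt_mul_of_pos_left hwq ht0
  clear_value z₁ z₂ z₃ b G
  have h9 : t * (3 / 4 - 1 / 4) < t * (1 / 8 + 1 / 8) := by linarith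
  have h10 := lt_of_mul_lt_mul_left h9 ht0.le
  norm_num at h10

/-- Directions z = ±i give max Re(zUF) = d₁(F) - d₂(UF) ≤ 0, so UF is real; then the seminorms
agree, and z = 1 compares the maxima. -/
theorem map_real {F : A₁} (hF : ∀ x, ((F : C(K₁, ℂ)) x).im = 0) :
    (∀ p, ((U F : C(K₂, ℂ)) p).im = 0) ∧ maxRe (U F : C(K₂, ℂ)) = maxRe (F : C(K₁, ℂ)) := by
  have hle := seminorm_le_of_real U hiso hd₁ hd₂ hU1 hsep hstar hF
  have hdiff := fun {z : ℂ} (hz : ‖z‖ = 1) =>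
    maxRe_smul_add_seminorm_eq U hiso hd₁ hd₂ hU1 F hz
  have him : ∀ z : ℂ, ‖z‖ = 1 → z.re = 0 → ∀ p, (z * (U F : C(K₂, ℂ)) p).re ≤ 0 := by
    intro z hz hz0 p
    have h1 := hdiff hz
    rw [maxRe_smul_of_real hF hz0.ge, hz0, zero_mul] at h1
    have h2 := re_le_maxRe (z • (U F : C(K₂, ℂ))) p
    rw [ContinuousMap.smul_apply, smul_eq_mul] at h2
    linarith
  have hzero : ∀ p, ((U F : C(K₂, ℂ)) p).im = 0 := by
    intro p
    have h1 := him Complex.I Complex.norm_I Complex.I_re p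
    have h2 := him (-Complex.I) (by rw [norm_neg, Complex.norm_I]) (by simp) p
    simp at h1 h2
    linarith
  refine ⟨hzero, ?_⟩
  have h1 := hdiff Complex.norm_I
  have h2 : maxRe (Complex.I • (U F : C(K₂, ℂ))) = 0 := by
    rw [maxRe_smul_of_real hzero (by simp)]
    simp
  rw [h2, maxRe_smul_of_real hF (by simp), Complex.I_re, zero_mul] at h1
  have h3 := hdiff norm_one
  rw [one_smul, one_smul] at h3
  linarith

variable [T2Space K₁] (hsep₁ : A₁.SeparatesPoints) (hstar₁ : ∀ f ∈ A₁, star f ∈ A₁)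

include hsep₁ hstar₁

theorem exists_forall_apply_eq (p : K₂) :
    ∃ x : K₁, ∀ F : A₁, (F : C(K₁, ℂ)) x = (U F : C(K₂, ℂ)) p := by
  have hreal := fun {F : A₁} hF => map_real U hiso hd₁ hd₂ hU1 hsep hstar (F := F) hF
  have hreal' := fun {G : A₂} hG => map_real U.symm (isometry_symm hiso) hd₂ hd₁
    (by rw [← hU1, U.symm_apply_apply]) hsep₁ hstar₁ (F := G) hG
  let ι := {F : A₁ // ∀ x, ((F : C(K₁, ℂ)) x).im = 0} × {ε : ℝ // 0 < ε}
  let Z : ι → Set K₁ := fun i =>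
    {x | ((i.1.1 : C(K₁, ℂ)) x).re ≤ ((U i.1.1 : C(K₂, ℂ)) p).re + i.2.1}
  have hZ : ∀ i, IsClosed (Z i) := fun i => isClosed_le
    (Complex.continuous_re.comp (i.1.1 : C(K₁, ℂ)).continuous) continuous_const
  have hne : (⋂ i, Z i).Nonempty := by
    rw [← Set.univ_inter (⋂ i, Z i)]
    refine isCompact_univ.inter_iInter_nonempty Z hZ fun s => ?_
    let W : Set K₂ := ⋂ i ∈ s, {y | ((U i.1.1 : C(K₂, ℂ)) y).re < ((U i.1.1 : C(K₂, ℂ)) p).re + i.2.1}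
    have hW : IsOpen W := isOpen_biInter_finset fun i _ => isOpen_lt
      (Complex.continuous_re.comp (U i.1.1 : C(K₂, ℂ)).continuous) continuous_const
    have hpW : p ∈ W := Set.mem_iInter₂.2 fun i _ => lt_add_of_pos_right _ i.2.2
    obtain ⟨E, hE, hEim, hE01, hE1, hEW⟩ := exists_peak hsep hstar hW hpW
    have hEmax : maxRe E = 1 := by
      refine le_antisymm (maxRe_le fun x => (hE01 x).2) ?_
      obtain ⟨x, hx⟩ := hE1
      exact hx ▸ re_le_maxRe E x
    obtain ⟨heim, hemax⟩ := hreal' (G := ⟨E, hE⟩) hEim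
    obtain ⟨x, hx⟩ := exists_re_eq_maxRe (U.symm ⟨E, hE⟩ : C(K₁, ℂ))
    refine ⟨x, Set.mem_univ x, Set.mem_iInter₂.2 fun i hi => ?_⟩
    -- Here x maximizes U⁻¹E. Moving U⁻¹E by tF raises its maximum at rate at least F(x), while the
    -- maximum of E + tUF grows more slowly, E peaking only in W; yet `map_real` equates the two
    -- maxima.
    by_contra! hcon
    have hcon : ((U i.1.1 : C(K₂, ℂ)) p).re + i.2.1 < ((i.1.1 : C(K₁, ℂ)) x).re :=
      not_le.1 hcon
    obtain ⟨t, ht, ht0⟩ := ((eventually_maxRe_add_smul_lt E (U i.1.1 : C(K₂, ℂ))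
      (α := ((U i.1.1 : C(K₂, ℂ)) p).re + i.2.1) fun y hy =>
        Set.mem_iInter₂.1 (hEW y (hEmax ▸ hy)) i hi).and self_mem_nhdsWithin).exists
    have ht0 : 0 < t := ht0
    have h1 := le_maxRe_add_smul (i.1.1 : C(K₁, ℂ)) hx t
    have h2 := (hreal (F := U.symm ⟨E, hE⟩ + (t : ℂ) • i.1.1) fun y => by
      simp [heim, i.1.2]).2
    have h3 : (U (U.symm ⟨E, hE⟩ + (t : ℂ) • i.1.1) : C(K₂, ℂ))
        = E + (t : ℂ) • (U i.1.1 : C(K₂, ℂ)) := by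
      rw [map_add, map_smul, U.apply_symm_apply]
      rfl
    have h4 : ((U.symm ⟨E, hE⟩ + (t : ℂ) • i.1.1 : A₁) : C(K₁, ℂ))
        = (U.symm ⟨E, hE⟩ : C(K₁, ℂ)) + (t : ℂ) • (i.1.1 : C(K₁, ℂ)) := rfl
    rw [h3, h4] at h2
    have h5 := mul_lt_mul_of_pos_left hcon ht0
    have hemax : maxRe (U.symm ⟨E, hE⟩ : C(K₁, ℂ)) = maxRe E := hemax
    linarith
  obtain ⟨x, hx⟩ := hne
  have hle : ∀ F : A₁, (∀ x, ((F : C(K₁, ℂ)) x).im = 0) →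
      ((F : C(K₁, ℂ)) x).re ≤ ((U F : C(K₂, ℂ)) p).re := fun F hF =>
    le_of_forall_pos_le_add fun ε hε => Set.mem_iInter.1 hx (⟨F, hF⟩, ⟨ε, hε⟩)
  have heq : ∀ F : A₁, (∀ x, ((F : C(K₁, ℂ)) x).im = 0) →
      (F : C(K₁, ℂ)) x = (U F : C(K₂, ℂ)) p := by
    intro F hF
    refine Complex.ext (le_antisymm (hle F hF) ?_) (by rw [hF, (hreal hF).1])
    have := hle (-F) fun y => by simp [hF]
    rw [map_neg] at this
    simpa using this
  refine ⟨x, fun F => ?_⟩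
  let S : A₁ := ⟨star (F : C(K₁, ℂ)), hstar₁ _ F.2⟩
  obtain ⟨P, Q, hP, hQ, rfl⟩ : ∃ P Q : A₁, (∀ y, ((P : C(K₁, ℂ)) y).im = 0) ∧
      (∀ y, ((Q : C(K₁, ℂ)) y).im = 0) ∧ F = P + Complex.I • Q := by
    refine ⟨(2⁻¹ : ℂ) • (F + S), (-Complex.I / 2) • (F - S), fun y => by simp [S],
      fun y => by simp [S], Subtype.ext (ContinuousMap.ext fun y => ?_)⟩
    simp only [Subalgebra.coe_add, Subalgebra.coe_smul, Subalgebra.coe_sub,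
      ContinuousMap.add_apply, ContinuousMap.smul_apply, ContinuousMap.sub_apply, smul_eq_mul]
    linear_combination (1 / 2 * ((F : C(K₁, ℂ)) y - (S : C(K₁, ℂ)) y)) * Complex.I_mul_I
  rw [map_add, map_smul]
  simp only [Subalgebra.coe_add, Subalgebra.coe_smul, ContinuousMap.add_apply,
    ContinuousMap.smul_apply, heq P hP, heq Q hQ]

/-- A unital surjective isometry is a composition operator. -/
theorem exists_homeomorph :
    ∃ σ : K₂ ≃ₜ K₁, ∀ (F : A₁) (p : K₂), (U F : C(K₂, ℂ)) p = (F : C(K₁, ℂ)) (σ p) := by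
  choose σ hσ using exists_forall_apply_eq U hiso hd₁ hd₂ hU1 hsep hstar hsep₁ hstar₁
  choose ρ hρ using exists_forall_apply_eq U.symm (isometry_symm hiso) hd₂ hd₁
    (by rw [← hU1, U.symm_apply_apply]) hsep₁ hstar₁ hsep hstar
  have hσc : Continuous σ := hsep₁.continuous_of_comp fun F => by
    simp only [hσ]
    exact (U F : C(K₂, ℂ)).continuous
  have hρc : Continuous ρ := hsep.continuous_of_comp fun F => by
    simp only [hρ]
    exact (U.symm F : C(K₁, ℂ)).continuous
  refine ⟨⟨⟨σ, ρ, fun p => ?_, fun x => ?_⟩, hσc, hρc⟩, fun F p => (hσ p F).symm⟩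
  · by_contra hne
    obtain ⟨f, ⟨f, hf, rfl⟩, hfne⟩ := hsep hne
    apply hfne
    have h1 := hρ (σ p) ⟨f, hf⟩
    have h2 := hσ p (U.symm ⟨f, hf⟩)
    rw [U.apply_symm_apply] at h2
    exact h1.trans h2
  · by_contra hne
    obtain ⟨f, ⟨f, hf, rfl⟩, hfne⟩ := hsep₁ hne
    apply hfne
    have h1 := hσ (ρ x) ⟨f, hf⟩
    have h2 := hρ x (U ⟨f, hf⟩)
    rw [U.symm_apply_apply] at h2
    exact h1.trans h2

end Unital

/-! ### Product structure of the homeomorphism. -/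

section Product

theorem exists_complex_ne_of_ne {Y : Type*} [TopologicalSpace Y] [CompactSpace Y] [T2Space Y]
    {y y' : Y} (h : y ≠ y') : ∃ g : C(Y, ℂ), g y ≠ g y' := by
  obtain ⟨e, he0, he1, -⟩ := exists_continuous_zero_one_of_isClosed
    (isClosed_singleton (x := y)) (isClosed_singleton (x := y')) (by simpa using h)
  refine ⟨⟨fun x => (e x : ℂ), by fun_prop⟩, ?_⟩
  have h0 := he0 (Set.mem_singleton y)
  have h1 := he1 (Set.mem_singleton y')
  simp only [Pi.zero_apply, Pi.one_apply] at h0 h1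
  simp [h0, h1]

/-- A homeomorphism of products over a homeomorphism of the second factors, in coordinates. -/
theorem exists_fiberwise_homeomorph {X₁ X₂ Y₁ Y₂ : Type*}
    [TopologicalSpace X₁] [T2Space X₁] [Nonempty X₁]
    [TopologicalSpace X₂] [CompactSpace X₂] [Nonempty X₂]
    [TopologicalSpace Y₁] [TopologicalSpace Y₂]
    (σ : X₂ × Y₂ ≃ₜ X₁ × Y₁) (h : ∀ x x' y, (σ (x, y)).2 = (σ (x', y)).2)
    (h' : ∀ x x' y, (σ.symm (x, y)).2 = (σ.symm (x', y)).2) :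
    ∃ (φ : C(X₂ × Y₂, X₁)) (τ : Y₂ ≃ₜ Y₁), (∀ y, IsHomeomorph fun x => φ (x, y)) ∧
      ∀ x y, σ (x, y) = (φ (x, y), τ y) := by
  obtain ⟨a₁⟩ := ‹Nonempty X₁›
  obtain ⟨a₂⟩ := ‹Nonempty X₂›
  have hl : ∀ x y, (σ.symm (x, (σ (a₂, y)).2)).2 = y := fun x y => by
    rw [h' x (σ (a₂, y)).1, Prod.mk.eta, σ.symm_apply_apply]
  have hr : ∀ x y, (σ (x, (σ.symm (a₁, y)).2)).2 = y := fun x y => by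
    rw [h x (σ.symm (a₁, y)).1, Prod.mk.eta, σ.apply_symm_apply]
  let φ : C(X₂ × Y₂, X₁) := ⟨fun p => (σ p).1, by fun_prop⟩
  let τ : Y₂ ≃ₜ Y₁ := ⟨⟨fun y => (σ (a₂, y)).2, fun y => (σ.symm (a₁, y)).2, hl a₁, hr a₂⟩,
    by fun_prop, by fun_prop⟩
  have hσ : ∀ x y, σ (x, y) = (φ (x, y), τ y) := fun x y => Prod.ext rfl (h x a₂ y)
  refine ⟨φ, τ, fun y => ?_, hσ⟩
  rw [isHomeomorph_iff_continuous_bijective]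
  refine ⟨by fun_prop, fun x x' hxx' => ?_, fun x => ⟨(σ.symm (x, τ y)).1, ?_⟩⟩
  · have hxx' : φ (x, y) = φ (x', y) := hxx'
    have h1 : σ (x, y) = σ (x', y) := by rw [hσ, hσ, hxx']
    exact congrArg Prod.fst (σ.injective h1)
  · have h1 : ((σ.symm (x, τ y)).1, y) = σ.symm (x, τ y) := Prod.ext rfl (hl x y).symm
    change (σ ((σ.symm (x, τ y)).1, y)).1 = x
    rw [h1, σ.apply_symm_apply]

/-- If a unital isometry onto `A₂` is composition with `σ`, and the seminorms vanish exactly on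
`1 ⊗ C(Y)`, then the second coordinate of `σ` depends only on the second variable. -/
theorem snd_apply_eq_of_isometry {X₁ X₂ Y₁ Y₂ : Type*}
    [TopologicalSpace X₁] [CompactSpace X₁] [TopologicalSpace Y₁] [CompactSpace Y₁] [T2Space Y₁]
    [TopologicalSpace X₂] [CompactSpace X₂] [TopologicalSpace Y₂] [CompactSpace Y₂]
    {A₁ : Subalgebra ℂ C(X₁ × Y₁, ℂ)} {A₂ : Subalgebra ℂ C(X₂ × Y₂, ℂ)}
    {d₁ : Seminorm ℂ A₁} {d₂ : Seminorm ℂ A₂}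
    (hA₁ : ∀ g : C(Y₁, ℂ), tensorFun 1 g ∈ A₁)
    (hker₁ : ∀ (F : A₁) (g : C(Y₁, ℂ)), (F : C(X₁ × Y₁, ℂ)) = tensorFun 1 g → d₁ F = 0)
    (hker₂ : ∀ F : A₂, d₂ F = 0 → ∃ g : C(Y₂, ℂ), (F : C(X₂ × Y₂, ℂ)) = tensorFun 1 g)
    (V : A₁ → A₂)
    (hiso : ∀ F, ‖(V F : C(X₂ × Y₂, ℂ))‖ + d₂ (V F) = ‖(F : C(X₁ × Y₁, ℂ))‖ + d₁ F)
    (σ : X₂ × Y₂ ≃ₜ X₁ × Y₁)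
    (hσ : ∀ F p, (V F : C(X₂ × Y₂, ℂ)) p = (F : C(X₁ × Y₁, ℂ)) (σ p)) (x x' : X₂) (y : Y₂) :
    (σ (x, y)).2 = (σ (x', y)).2 := by
  by_contra hne
  obtain ⟨g, hg⟩ := exists_complex_ne_of_ne hne
  let F : A₁ := ⟨tensorFun 1 g, hA₁ g⟩
  -- As d₁(F) = 0, this inequality leaves no room for d₂(VF), so VF lies in 1 ⊗ C(Y₂).
  have hnorm : ‖(F : C(X₁ × Y₁, ℂ))‖ ≤ ‖(V F : C(X₂ × Y₂, ℂ))‖ := by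
    refine (ContinuousMap.norm_le _ (norm_nonneg _)).2 fun q => ?_
    have h1 := (V F : C(X₂ × Y₂, ℂ)).norm_coe_le_norm (σ.symm q)
    rwa [hσ, σ.apply_symm_apply] at h1
  have h2 := hiso F
  rw [hker₁ F g rfl] at h2
  have h3 : d₂ (V F) = 0 := le_antisymm (by linarith) (apply_nonneg d₂ _)
  obtain ⟨g', hg'⟩ := hker₂ _ h3
  have hval : ∀ x, g (σ (x, y)).2 = g' y := fun x => by
    have h4 := hσ F (x, y)
    rw [hg'] at h4
    simpa [F, tensorFun] using h4.symm
  exact hg ((hval x).trans (hval x').symm)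

end Product

/-! ### From valuezations to seminorms. -/

section Valuezation

theorem tensorFun_one_mem {X : Type u} {Y : Type v}
    [TopologicalSpace X] [CompactSpace X] [T2Space X]
    [TopologicalSpace Y] [CompactSpace Y] [T2Space Y]
    {B : Subalgebra ℂ C(X, ℂ)} {nB : AlgebraNorm ℂ B}
    {Bt : Subalgebra ℂ C(X × Y, ℂ)} {nBt : AlgebraNorm ℂ Bt}
    (hv : IsNaturalValuezation.{u, v, w} B nB Bt nBt) (g : C(Y, ℂ)) : tensorFun 1 g ∈ Bt :=
  hv.tensor_le (Submodule.subset_span ⟨1, B.one_mem, g, trivial, rfl⟩)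

/-- The norm of a natural valuezation is the supremum norm plus a seminorm that vanishes exactly
on `1 ⊗ C(Y)`. -/
theorem exists_seminorm {X : Type u} {Y : Type v}
    [TopologicalSpace X] [CompactSpace X] [T2Space X]
    [TopologicalSpace Y] [CompactSpace Y] [T2Space Y]
    {B : Subalgebra ℂ C(X, ℂ)} {nB : AlgebraNorm ℂ B}
    {Bt : Subalgebra ℂ C(X × Y, ℂ)} {nBt : AlgebraNorm ℂ Bt}
    (hv : IsNaturalValuezation.{u, v, w} B nB Bt nBt) :
    ∃ d : Seminorm ℂ Bt,
      (∀ F : Bt, d F = 0 ↔ ∃ g : C(Y, ℂ), (F : C(X × Y, ℂ)) = tensorFun 1 g) ∧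
      ∀ F : Bt, nBt F = ‖(F : C(X × Y, ℂ))‖ + d F := by
  obtain ⟨M, _, _, _, D, hker, -, hnorm⟩ := hv.exists_map
  refine ⟨(normSeminorm ℂ C(M, ℂ)).comp D, fun F => ?_, fun F => ?_⟩
  · rw [← hker, Seminorm.comp_apply, coe_normSeminorm, norm_eq_zero]
  · rw [hnorm, Seminorm.comp_apply, coe_normSeminorm]

theorem tensorFun_one_mul_star {X Y : Type*} [TopologicalSpace X] [TopologicalSpace Y]
    {h : C(Y, ℂ)} (hh : ∀ y, ‖h y‖ = 1) :
    (tensorFun 1 h * tensorFun 1 (star h) : C(X × Y, ℂ)) = 1 := by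
  ext p
  simp [tensorFun, Complex.mul_conj', hh]

end Valuezation

/-! ### Reduction to the unital case and conclusion. -/

theorem theorem5p1
    {X₁ X₂ Y₁ Y₂ : Type*}
    [TopologicalSpace X₁] [CompactSpace X₁] [T2Space X₁] [Nonempty X₁]
    [TopologicalSpace X₂] [CompactSpace X₂] [T2Space X₂] [Nonempty X₂]
    [TopologicalSpace Y₁] [CompactSpace Y₁] [T2Space Y₁] [Nonempty Y₁]
    [TopologicalSpace Y₂] [CompactSpace Y₂] [T2Space Y₂] [Nonempty Y₂]
    (B₁ : Subalgebra ℂ C(X₁, ℂ)) (nB₁ : AlgebraNorm ℂ B₁)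
    (Bt₁ : Subalgebra ℂ C(X₁ × Y₁, ℂ)) (nBt₁ : AlgebraNorm ℂ Bt₁)
    (B₂ : Subalgebra ℂ C(X₂, ℂ)) (nB₂ : AlgebraNorm ℂ B₂)
    (Bt₂ : Subalgebra ℂ C(X₂ × Y₂, ℂ)) (nBt₂ : AlgebraNorm ℂ Bt₂)
    (hv₁ : IsNaturalValuezation.{_, _, w₁} B₁ nB₁ Bt₁ nBt₁)
    (hv₂ : IsNaturalValuezation.{_, _, w₂} B₂ nB₂ Bt₂ nBt₂)
    (hinv₁ : ∀ (h : C(Y₁, ℂ)), (∀ y, ‖h y‖ = 1) → ∀ F G : Bt₁,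
      (G : C(X₁ × Y₁, ℂ)) = tensorFun 1 h * (F : C(X₁ × Y₁, ℂ)) → nBt₁ G = nBt₁ F)
    (hinv₂ : ∀ (h : C(Y₂, ℂ)), (∀ y, ‖h y‖ = 1) → ∀ F G : Bt₂,
      (G : C(X₂ × Y₂, ℂ)) = tensorFun 1 h * (F : C(X₂ × Y₂, ℂ)) → nBt₂ G = nBt₂ F)
    (U : Bt₁ →ₗ[ℂ] Bt₂) (hU : Function.Surjective U) (hiso : ∀ F : Bt₁, nBt₂ (U F) = nBt₁ F) :
    ∃ (h : C(Y₂, ℂ)) (φ : C(X₂ × Y₂, X₁)) (τ : Y₂ ≃ₜ Y₁),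
      (∀ y, ‖h y‖ = 1) ∧
      (∀ y, IsHomeomorph (fun x => φ (x, y))) ∧
      ∀ (F : Bt₁) (x : X₂) (y : Y₂),
        (U F : C(X₂ × Y₂, ℂ)) (x, y) = h y * (F : C(X₁ × Y₁, ℂ)) (φ (x, y), τ y) := by
  obtain ⟨d₁, hker₁, hn₁⟩ := exists_seminorm hv₁
  obtain ⟨d₂, hker₂, hn₂⟩ := exists_seminorm hv₂
  have hd₁ : d₁ 1 = 0 := (hker₁ 1).2 ⟨1, by ext p; simp [tensorFun]⟩
  have hd₂ : d₂ 1 = 0 := (hker₂ 1).2 ⟨1, by ext p; simp [tensorFun]⟩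
  have hinj : Function.Injective U := by
    rw [← LinearMap.ker_eq_bot, LinearMap.ker_eq_bot']
    intro F hF
    have h1 := hiso F
    rw [hn₁, hn₂, hF, (hker₂ 0).2 ⟨0, by ext p; simp [tensorFun]⟩] at h1
    have h2 : ‖(F : C(X₁ × Y₁, ℂ))‖ ≤ 0 := by
      have h3 := apply_nonneg d₁ F
      have h4 : ‖((0 : Bt₂) : C(X₂ × Y₂, ℂ))‖ = 0 := norm_zero
      linarith
    exact Subtype.ext (norm_le_zero_iff.1 h2)
  let Ue : Bt₁ ≃ₗ[ℂ] Bt₂ := LinearEquiv.ofBijective U ⟨hinj, hU⟩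
  have hUe : ∀ F, Ue F = U F := fun F => rfl
  have hisoe : ∀ F, ‖(Ue F : C(X₂ × Y₂, ℂ))‖ + d₂ (Ue F) = ‖(F : C(X₁ × Y₁, ℂ))‖ + d₁ F :=
    fun F => by rw [← hn₁, ← hn₂, hUe, hiso]
  have hone := one_le_norm_map_one Ue hisoe hd₁ hd₂ hv₂.separates hv₂.selfAdjoint.2
  have hsum := norm_add_seminorm_map_one Ue hisoe hd₁
  have hd0 := apply_nonneg d₂ (Ue 1)
  obtain ⟨h, hh⟩ := (hker₂ (Ue 1)).1 (by linarith)
  obtain ⟨a₂⟩ := ‹Nonempty X₂›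
  have hunit : ∀ y, ‖h y‖ = 1 := fun y => by
    have h1 := norm_map_one_apply Ue hisoe hd₁ hv₂.separates hv₂.selfAdjoint.2 (a₂, y)
    rw [show ‖(Ue 1 : C(X₂ × Y₂, ℂ))‖ = 1 by linarith, hh] at h1
    simpa [tensorFun] using h1
  have hstar : ∀ y, ‖star h y‖ = 1 := fun y => by simp [hunit]
  let m : Bt₂ := ⟨tensorFun 1 h, tensorFun_one_mem hv₂ h⟩
  let m' : Bt₂ := ⟨tensorFun 1 (star h), tensorFun_one_mem hv₂ (star h)⟩
  have hmm : m * m' = 1 := Subtype.ext (tensorFun_one_mul_star hunit)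
  have hmm' : m' * m = 1 := by rw [mul_comm, hmm]
  let E : Bt₂ ≃ₗ[ℂ] Bt₂ := LinearEquiv.ofLinearMap (LinearMap.mulLeft ℂ m') (LinearMap.mulLeft ℂ m)
    (LinearMap.ext fun F => by simp [← mul_assoc, hmm'])
    (LinearMap.ext fun F => by simp [← mul_assoc, hmm])
  have hE : ∀ F, E F = m' * F := fun F => rfl
  let V : Bt₁ ≃ₗ[ℂ] Bt₂ := Ue.trans E
  have hV : ∀ F, V F = m' * U F := fun F => rfl
  -- Invariance under unimodular multipliers from C(Y₂) keeps the normalized map isometric.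
  have hisoV : ∀ F, ‖(V F : C(X₂ × Y₂, ℂ))‖ + d₂ (V F) = ‖(F : C(X₁ × Y₁, ℂ))‖ + d₁ F :=
    fun F => by rw [← hn₁, ← hn₂, hinv₂ (star h) hstar (U F) (V F) rfl, hiso]
  have hV1 : V 1 = 1 := by
    rw [hV, ← hUe, show Ue 1 = m from Subtype.ext hh, hmm']
  obtain ⟨σ, hσ⟩ := exists_homeomorph V hisoV hd₁ hd₂ hV1 hv₂.separates hv₂.selfAdjoint.2
    hv₁.separates hv₁.selfAdjoint.2
  have : Nonempty X₂ := ⟨a₂⟩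
  obtain ⟨φ, τ, hφ, hφτ⟩ := exists_fiberwise_homeomorph σ
    (snd_apply_eq_of_isometry (tensorFun_one_mem hv₁) (fun F g hg => (hker₁ F).2 ⟨g, hg⟩)
      (fun F => (hker₂ F).1) V hisoV σ hσ)
    (snd_apply_eq_of_isometry (tensorFun_one_mem hv₂) (fun F g hg => (hker₂ F).2 ⟨g, hg⟩)
      (fun F => (hker₁ F).1) V.symm (isometry_symm hisoV) σ.symm fun F p => by
        rw [← σ.apply_symm_apply p, ← hσ, V.apply_symm_apply, σ.apply_symm_apply])
  refine ⟨h, φ, τ, hunit, hφ, fun F x y => ?_⟩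
  have h1 : U F = m * V F := by rw [hV, ← mul_assoc, hmm, one_mul]
  rw [h1, ← hφτ, ← hσ]
  simp [m, tensorFun]
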